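/- Let $A\in\mathbb{R}^{n\times n}$ be a real symmetric positive definite matrix with smallest eigenvalue $\lambda_{\min}$ and largest eigenvalue $\lambda_{\max}$, where $\lambda_{\min}<\lambda_{\max}<1$, and let $\kappa=\lambda_{\max}/\lambda_{\min}$ be its condition number. Let $\epsilon,\eta\in(0,1)$ and let $m\ge 0$, $N$ be integers with $$m\;\ge\;\frac{1}{2\log\rho_2}\,\log\!\left(\frac{K_{\rho_2}}{\epsilon\,\log\!\left(\kappa^{1/n}/\lambda_{\max}\right)}\right),\qquad N\;\ge\;\frac{24}{\epsilon^{2}}\,\log\frac{2}{\eta},$$ where $$\rho_2=\frac{\lambda_{\max}+\sqrt{2\lambda_{\min}\lambda_{\max}-\lambda_{\min}^2}}{\lambda_{\max}-\lambda_{\min}},\qquad K_{\rho_2}=\frac{8M_{\rho_2}}{\rho_2^2-\rho_2},\qquad M_{\rho_2}=\sqrt{\left(\log\frac{\lambda_{\min}}{2}\right)^{2}+\pi^2}.$$ Let $z^{(1)},\dots,z^{(N)}$ be independent Rademacher vectors in $\mathbb{R}^n$ (all entries independent, equal to $+1$ or $-1$ with probability $1/2$ each), and let the stochastic Lanczos quadrature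 (SLQ) approximation of $\log\det A$ be $$[\log\det A]_L=\frac{n}{N}\sum_{i=1}^{N}\sum_{k}\tau^{(i)}_k\log\theta^{(i)}_k ,$$ where $\theta^{(i)}_k$ are the eigenvalues of the $(m+1)\times(m+1)$ symmetric tridiagonal matrix produced by $m$ steps of the Lanczos iteration for $A$ started at $z^{(i)}/\sqrt n$, and $\tau^{(i)}_k$ are the squares of the first entries of the corresponding orthonormal eigenvectors. (In exact arithmetic the Lanczos iteration with starting vector $v$ is $v_1=v/\|v\|_2$, $\alpha_k=v_k^TAv_k$, $\tilde v_{k+1}=Av_k-\alpha_kv_k-\beta_{k-1}v_{k-1}$ with $\beta_0v_0=0$, $\beta_k=\|\tilde v_{k+1}\|_2$, $v_{k+1}=\tilde v_{k+1}/\beta_k$; the tridiagonal matrix has diagonal $\alpha_1,\dots,\alpha_{m+1}$ and off-diagonal $\beta_1,\dots,\beta_m$. If some $\beta_k=0$ with $k\le m$, the iteration stops and the leading $k\times k$ matrix is used for the first such $k$.) Then $$\mathbb{P}\Big\{\big|\log\det A-[\log\det A]_L\big|\le\epsilon\,|\log\det A|\Big\}\ge 1-\eta .$$ -/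

import Mathlib

open MeasureTheory ProbabilityTheory Matrix

noncomputable section

namespace SLQ

/-- The Euclidean norm of a vector of real numbers (`Fin n → ℝ` itself carries the sup norm). -/
def norm2 {n : ℕ} (w : Fin n → ℝ) : ℝ := Real.sqrt (w ⬝ᵥ w)

/-- The normalized vector `w / ‖w‖₂`. -/
def normalized {n : ℕ} (w : Fin n → ℝ) : Fin n → ℝ := (norm2 w)⁻¹ • w

/-- The unnormalized Lanczos vectors, indexed from `0`: the starting vector `v`, then
`A v₀ - α₀ v₀`, then `A vₖ - αₖ vₖ - βₖ vₖ₋₁`, where `vₖ` is the normalization of the `k`-th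
unnormalized vector, `βₖ` its Euclidean norm and `αₖ = vₖᵀ A vₖ`. -/
def lanczosResidual {n : ℕ} (A : Matrix (Fin n) (Fin n) ℝ) (v : Fin n → ℝ) : ℕ → (Fin n → ℝ)
  | 0 => v
  | 1 => A *ᵥ normalized v - (normalized v ⬝ᵥ A *ᵥ normalized v) • normalized v
  | k + 2 =>
    A *ᵥ normalized (lanczosResidual A v (k + 1))
      - (normalized (lanczosResidual A v (k + 1)) ⬝ᵥ
          A *ᵥ normalized (lanczosResidual A v (k + 1))) •
          normalized (lanczosResidual A v (k + 1))
      - norm2 (lanczosResidual A v (k + 1)) • normalized (lanczosResidual A v k)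

/-- The Lanczos vector `vₖ` (`k = 0, 1, …`). -/
def lanczosVec {n : ℕ} (A : Matrix (Fin n) (Fin n) ℝ) (v : Fin n → ℝ) (k : ℕ) : Fin n → ℝ :=
  normalized (lanczosResidual A v k)

/-- The diagonal coefficient `αₖ = vₖᵀ A vₖ`. -/
def lanczosAlpha {n : ℕ} (A : Matrix (Fin n) (Fin n) ℝ) (v : Fin n → ℝ) (k : ℕ) : ℝ :=
  lanczosVec A v k ⬝ᵥ A *ᵥ lanczosVec A v k

/-- The coefficient `βₖ`, the norm of the `k`-th unnormalized vector; for `k ≥ 1` it couples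
`vₖ₋₁` and `vₖ`. -/
def lanczosBeta {n : ℕ} (A : Matrix (Fin n) (Fin n) ℝ) (v : Fin n → ℝ) (k : ℕ) : ℝ :=
  norm2 (lanczosResidual A v k)

open Classical in
/-- The number of Lanczos steps that are carried out when `m` are requested: the iteration stops
early at a breakdown, that is, as soon as the next unnormalized vector vanishes (and `βₖ = 0`
could not be divided by). Without a breakdown it is `m`. -/
def lanczosSteps {n : ℕ} (A : Matrix (Fin n) (Fin n) ℝ) (v : Fin n → ℝ) (m : ℕ) : ℕ :=
  Nat.findGreatest (fun k => ∀ j < k, lanczosResidual A v (j + 1) ≠ 0) m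

/-- The symmetric tridiagonal matrix of order `d + 1` with diagonal `α₀, …, α_d` and
off-diagonal `β₁, …, β_d`. -/
def lanczosT {n : ℕ} (A : Matrix (Fin n) (Fin n) ℝ) (v : Fin n → ℝ) (d : ℕ) :
    Matrix (Fin (d + 1)) (Fin (d + 1)) ℝ :=
  Matrix.of fun i j =>
    if (i : ℕ) = j then lanczosAlpha A v i
    else if (i : ℕ) + 1 = j then lanczosBeta A v j
    else if (j : ℕ) + 1 = i then lanczosBeta A v i
    else 0

theorem lanczosT_isHermitian {n : ℕ} (A : Matrix (Fin n) (Fin n) ℝ) (v : Fin n → ℝ) (d : ℕ) :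
    (lanczosT A v d).IsHermitian := by
  ext i j
  simp only [Matrix.conjTranspose_apply, lanczosT, Matrix.of_apply, star_trivial]
  split_ifs <;> first | rfl | omega | congr 1

/-- The quadrature nodes: the eigenvalues of the tridiagonal matrix. -/
def lanczosNode {n : ℕ} (A : Matrix (Fin n) (Fin n) ℝ) (v : Fin n → ℝ) (d : ℕ)
    (k : Fin (d + 1)) : ℝ :=
  (lanczosT_isHermitian A v d).eigenvalues k

/-- The quadrature weights: the squared first entries of the orthonormal eigenvectors. -/
def lanczosWeight {n : ℕ} (A : Matrix (Fin n) (Fin n) ℝ) (v : Fin n → ℝ) (d : ℕ)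
    (k : Fin (d + 1)) : ℝ :=
  ((lanczosT_isHermitian A v d).eigenvectorBasis k 0) ^ 2

/-- The `m`-step (`m + 1` nodes, unless the iteration breaks down earlier) Lanczos quadrature
of the logarithm, started at `v`. -/
def lanczosQuadrature {n : ℕ} (A : Matrix (Fin n) (Fin n) ℝ) (m : ℕ) (v : Fin n → ℝ) : ℝ :=
  ∑ k : Fin (lanczosSteps A v m + 1),
    lanczosWeight A v (lanczosSteps A v m) k * Real.log (lanczosNode A v (lanczosSteps A v m) k)

/-- The stochastic Lanczos quadrature approximation `[log det A]_L` computed with `m` Lanczos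
steps from the `N` query vectors `z 0, …, z (N - 1)`. -/
def slqLogDet {n : ℕ} (A : Matrix (Fin n) (Fin n) ℝ) (m N : ℕ) (z : Fin N → Fin n → ℝ) : ℝ :=
  (n : ℝ) / N * ∑ i : Fin N, lanczosQuadrature A m ((Real.sqrt n)⁻¹ • z i)

/-- `z` is a family of `N` independent Rademacher vectors in dimension `n`: all entries are
independent and take the values `1` and `-1` with probability one half each. -/
structure IsRademacherFamily {Ω : Type*} [MeasurableSpace Ω] (P : Measure Ω) {N n : ℕ}
    (z : Fin N → Fin n → Ω → ℝ) : Prop where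
  measurable : ∀ i j, Measurable (z i j)
  prob_one : ∀ i j, P {ω | z i j ω = 1} = 1 / 2
  prob_neg_one : ∀ i j, P {ω | z i j ω = -1} = 1 / 2
  indep : iIndepFun (fun p : Fin N × Fin n => z p.1 p.2) P

/-- The elliptical radius `ρ₂`. -/
def rho2 (lmin lmax : ℝ) : ℝ :=
  (lmax + Real.sqrt (2 * lmin * lmax - lmin ^ 2)) / (lmax - lmin)

/-- The constant `M_{ρ₂}`. -/
def Mrho2 (lmin : ℝ) : ℝ := Real.sqrt (Real.log (lmin / 2) ^ 2 + Real.pi ^ 2)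

/-- The constant `K_{ρ₂}`. -/
def Krho2 (lmin lmax : ℝ) : ℝ := 8 * Mrho2 lmin / (rho2 lmin lmax ^ 2 - rho2 lmin lmax)

end SLQ

end

/-! All eigenvalues lie in `(0, 1)`, so `-log A` is positive definite with trace `W = -log det A`.
The error splits into sampling error and quadrature error, each kept below `(ε / 2) * W`.

Quadrature: Lanczos gives the Gauss rule of the spectral measure of `A` at the starting vector,
exact in degree `2m + 1` (`lanczos_quadrature_exact`). Both measures are probability measures on
`[lmin, lmax]`, so the error is at most twice the uniform distance from `log` to polynomials
(`abs_lanczosQuadrature_sub_le`). That distance comes from the explicit Chebyshev series of `log`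
(`exists_polynomial_log`) instead of a bound on an ellipse, so of `Mrho2` only a crude lower bound
is used.

Sampling: the quadratic form of `-log A / W` at a sign vector is a convex combination of squares of
Rademacher sums with unit coefficient vectors. Jensen reduces its exponential moments to one such
square, and Chernoff bounds on both tails give `hutchinson_concentration`. -/

namespace SLQ

/-! ### Chebyshev approximation of the logarithm -/

/-- The Fourier series of `log |1 + r e^{iθ}|²`. -/
theorem hasSum_log_one_add_two_mul_cos {r : ℝ} (hr0 : 0 ≤ r) (hr1 : r < 1) (θ : ℝ) :
    HasSum (fun k : ℕ => -2 * (-r) ^ k / k * Real.cos (k * θ))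
      (Real.log (1 + 2 * r * Real.cos θ + r ^ 2)) := by
  set z : ℂ := ((-r : ℝ) : ℂ) * Complex.exp (θ * Complex.I) with hz
  have hnz : ‖z‖ < 1 := by
    rw [hz, norm_mul, Complex.norm_exp_ofReal_mul_I, Complex.norm_real]
    simpa [abs_of_nonneg hr0] using hr1
  have h := Complex.hasSum_re (Complex.hasSum_taylorSeries_neg_log hnz)
  have h2 := h.mul_left (-2)
  have hpow : ∀ k : ℕ, (z ^ k / (k : ℂ)).re = (-r) ^ k / k * Real.cos (k * θ) := by
    intro k
    have : z ^ k / (k : ℂ) = (((-r) ^ k / k : ℝ) : ℂ) * Complex.exp ((k * θ : ℝ) * Complex.I) := by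
      rw [hz, mul_pow, ← Complex.exp_nat_mul]
      push_cast
      ring_nf
    rw [this, Complex.re_ofReal_mul, Complex.exp_ofReal_mul_I_re]
  have hnorm : 1 + 2 * r * Real.cos θ + r ^ 2 = ‖1 - z‖ ^ 2 := by
    rw [← Complex.normSq_eq_norm_sq, Complex.normSq_apply]
    have h1 : (1 - z).re = 1 + r * Real.cos θ := by
      rw [hz, Complex.sub_re, Complex.re_ofReal_mul, Complex.exp_ofReal_mul_I_re]; simp
    have h2 : (1 - z).im = r * Real.sin θ := by
      rw [hz, Complex.sub_im, Complex.im_ofReal_mul, Complex.exp_ofReal_mul_I_im]; simp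
    rw [h1, h2]
    linear_combination -r ^ 2 * Real.sin_sq_add_cos_sq θ
  convert! h2 using 1
  · ext k
    rw [hpow]; ring
  · rw [hnorm, Real.log_pow, Complex.neg_re, Complex.log_re]
    push_cast; ring

-- With `x = cos θ` the Fourier series becomes a Chebyshev series with coefficients of size `2 * r ^
-- k / k`. For `k ≥ 2` this is at most `r ^ k`, so the tail is geometric; this is where `1 ≤ d`
-- enters.
open Polynomial in
theorem exists_polynomial_log_one_add {r : ℝ} (hr0 : 0 ≤ r) (hr1 : r < 1) {d : ℕ} (hd : 1 ≤ d) :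
    ∃ p : ℝ[X], p.natDegree ≤ d ∧ ∀ x : ℝ, |x| ≤ 1 →
      |Real.log (1 + 2 * r * x + r ^ 2) - p.eval x| ≤ r ^ (d + 1) / (1 - r) := by
  -- The `k = 0` coefficient is a division by zero, hence `0`, in agreement with the missing
  -- constant term of the series.
  refine ⟨∑ k ∈ Finset.range (d + 1), C (-2 * (-r) ^ k / k) * Chebyshev.T ℝ k, ?_, ?_⟩
  · refine natDegree_sum_le_of_forall_le _ _ fun k hk => ?_
    refine (natDegree_C_mul_le _ _).trans ?_
    rw [Chebyshev.natDegree_T]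
    simpa [Nat.lt_succ_iff] using hk
  · intro x hx
    rw [abs_le] at hx
    obtain ⟨θ, rfl⟩ : ∃ θ, Real.cos θ = x := ⟨Real.arccos x, Real.cos_arccos hx.1 hx.2⟩
    have hs := hasSum_log_one_add_two_mul_cos hr0 hr1 θ
    have htail := (hasSum_nat_add_iff' (d + 1)).2 hs
    have heval : (∑ k ∈ Finset.range (d + 1), C (-2 * (-r) ^ k / k) * Chebyshev.T ℝ k).eval
        (Real.cos θ) = ∑ k ∈ Finset.range (d + 1), -2 * (-r) ^ k / k * Real.cos (k * θ) := by
      rw [eval_finsetSum]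
      refine Finset.sum_congr rfl fun k _ => ?_
      rw [eval_mul, eval_C, Chebyshev.T_real_cos]
      simp
    rw [heval]
    have hg : HasSum (fun k : ℕ => r ^ (d + 1) * r ^ k) (r ^ (d + 1) / (1 - r)) := by
      rw [div_eq_mul_inv]
      exact (hasSum_geometric_of_lt_one hr0 hr1).mul_left _
    rw [← htail.tsum_eq, ← Real.norm_eq_abs]
    refine tsum_of_norm_bounded hg fun k => ?_
    have h2 : (2 : ℝ) / ((k + (d + 1) : ℕ) : ℝ) ≤ 1 := by
      rw [div_le_one (by positivity)]
      exact_mod_cast (by omega : 2 ≤ k + (d + 1))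
    calc ‖-2 * (-r) ^ (k + (d + 1)) / ((k + (d + 1) : ℕ) : ℝ)
          * Real.cos ((k + (d + 1) : ℕ) * θ)‖
        = 2 / ((k + (d + 1) : ℕ) : ℝ) * r ^ (k + (d + 1))
            * |Real.cos ((k + (d + 1) : ℕ) * θ)| := by
          simp only [Real.norm_eq_abs, abs_mul, abs_div, abs_pow, abs_neg, abs_of_nonneg hr0,
            Nat.abs_cast, Nat.abs_ofNat]
          ring
      _ ≤ 1 * r ^ (k + (d + 1)) * 1 := by
          gcongr
          exact Real.abs_cos_le_one _
      _ = r ^ (d + 1) * r ^ k := by ring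

theorem one_lt_rho2 {a b : ℝ} (ha : 0 < a) (hab : a < b) : 1 < rho2 a b := by
  rw [rho2, one_lt_div (by linarith)]
  have := Real.sqrt_nonneg (2 * a * b - a ^ 2)
  linarith

/-- Uniform polynomial approximation of the logarithm on `[a, b]` at the rate `ρ₂`. -/
theorem exists_polynomial_log {a b : ℝ} (ha : 0 < a) (hab : a < b) (m : ℕ) :
    ∃ p : Polynomial ℝ, p.natDegree ≤ 2 * m + 1 ∧ ∀ t ∈ Set.Icc a b,
      |Real.log t - p.eval t| ≤ 1 / (rho2 a b ^ 2 - rho2 a b) / rho2 a b ^ (2 * m) := by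
  have hb : 0 < b := ha.trans hab
  have hba : 0 < b - a := by linarith
  set ρ := rho2 a b with hρ
  have hρ1 : 1 < ρ := one_lt_rho2 ha hab
  obtain ⟨u, hu, rfl⟩ : ∃ u : ℝ, 0 < u ∧ u ^ 2 = a :=
    ⟨√a, Real.sqrt_pos.2 ha, Real.sq_sqrt ha.le⟩
  obtain ⟨v, hv, rfl⟩ : ∃ v : ℝ, 0 < v ∧ v ^ 2 = b :=
    ⟨√b, Real.sqrt_pos.2 hb, Real.sq_sqrt hb.le⟩
  have huv : u < v := lt_of_pow_lt_pow_left₀ 2 hv.le hab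
  -- This `r` makes `1 + 2 * r * x + r ^ 2` a constant multiple of `t` when `x` is the affine image
  -- of `t` in `[-1, 1]`. It is the optimal rate; `ρ₂` is a weaker one, since `ρ₂ ≤ (v + u) / (v -
  -- u)`.
  set r : ℝ := (v - u) / (v + u) with hr
  have hr0 : 0 < r := div_pos (by linarith) (by linarith)
  have hr1 : r < 1 := (div_lt_one (by linarith)).2 (by linarith)
  have hrρ : r ≤ ρ⁻¹ := by
    rw [le_inv_comm₀ hr0 (by linarith), hρ, rho2, hr, inv_div, div_le_div_iff₀ hba (by linarith)]
    have hs : √(2 * u ^ 2 * v ^ 2 - (u ^ 2) ^ 2) ≤ 2 * u * v := by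
      rw [Real.sqrt_le_left (by positivity)]
      nlinarith [mul_pos hu hv, sq_nonneg (u * v), sq_nonneg (u ^ 2)]
    have : v ^ 2 + √(2 * u ^ 2 * v ^ 2 - (u ^ 2) ^ 2) ≤ (v + u) ^ 2 := by
      nlinarith [sq_nonneg u]
    calc _ ≤ (v + u) ^ 2 * (v - u) := by gcongr
      _ = _ := by ring
  obtain ⟨q, hq, hqb⟩ := exists_polynomial_log_one_add hr0.le hr1 (d := 2 * m + 1) (by omega)
  refine ⟨q.comp (Polynomial.C (2 / (v ^ 2 - u ^ 2)) * Polynomial.X +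
    Polynomial.C (-(u ^ 2 + v ^ 2) / (v ^ 2 - u ^ 2))) -
    Polynomial.C (Real.log (4 * r / (v ^ 2 - u ^ 2))), ?_, ?_⟩
  · rw [Polynomial.natDegree_sub_C]
    refine Polynomial.natDegree_comp_le.trans ?_
    calc _ ≤ q.natDegree * 1 := Nat.mul_le_mul_left _ Polynomial.natDegree_linear_le
      _ ≤ _ := by simpa using hq
  · intro t ht
    have ht0 : 0 < t := ha.trans_le ht.1
    set x : ℝ := 2 / (v ^ 2 - u ^ 2) * t + -(u ^ 2 + v ^ 2) / (v ^ 2 - u ^ 2) with hx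
    have hx' : x = (2 * t - (u ^ 2 + v ^ 2)) / (v ^ 2 - u ^ 2) := by rw [hx]; ring
    have hx1 : |x| ≤ 1 := by
      rw [hx', abs_le, le_div_iff₀ hba, div_le_iff₀ hba]
      constructor <;> nlinarith [ht.1, ht.2]
    have hid : 1 + 2 * r * x + r ^ 2 = 4 * r / (v ^ 2 - u ^ 2) * t := by
      have h1 : v + u ≠ 0 := by positivity
      have h2 : v - u ≠ 0 := by linarith
      have h3 : v ^ 2 - u ^ 2 = (v - u) * (v + u) := by ring
      rw [hx', hr, h3]
      field_simp
      ring
    have hlog : Real.log (1 + 2 * r * x + r ^ 2)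
        = Real.log (4 * r / (v ^ 2 - u ^ 2)) + Real.log t := by
      rw [hid, Real.log_mul (by positivity) ht0.ne']
    have := hqb x hx1
    simp only [Polynomial.eval_sub, Polynomial.eval_comp, Polynomial.eval_add,
      Polynomial.eval_mul, Polynomial.eval_C, Polynomial.eval_X]
    rw [← hx]
    rw [hlog] at this
    calc _ = |Real.log (4 * r / (v ^ 2 - u ^ 2)) + Real.log t - Polynomial.eval x q| := by
          congr 1; ring
      _ ≤ _ := this
      -- Degree `2m + 1` leaves a tail from exponent `2m + 2`; two of these powers and the geometric
      -- factor produce the denominator `ρ ^ 2 - ρ`.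
      _ ≤ ρ⁻¹ ^ (2 * m + 1 + 1) / (1 - ρ⁻¹) := by
          have : ρ⁻¹ < 1 := inv_lt_one_of_one_lt₀ hρ1
          gcongr
      _ = _ := by
          have h0 : ρ ≠ 0 := by positivity
          have h1 : ρ - 1 ≠ 0 := by linarith
          have h2 : ρ ^ 2 - ρ = ρ * (ρ - 1) := by ring
          have h3 : 1 - ρ⁻¹ = (ρ - 1) / ρ := by field_simp
          rw [h2, h3, inv_pow]
          field_simp
          ring

/-! ### Spectral measure of a symmetric matrix at a vector -/

section Spectral

variable {n : ℕ} {A : Matrix (Fin n) (Fin n) ℝ}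

theorem eigenvectorBasis_dotProduct (hA : A.IsHermitian) (i j : Fin n) :
    (hA.eigenvectorBasis i : Fin n → ℝ) ⬝ᵥ hA.eigenvectorBasis j = if i = j then 1 else 0 := by
  have := orthonormal_iff_ite.1 hA.eigenvectorBasis.orthonormal i j
  rw [← this, EuclideanSpace.inner_eq_star_dotProduct, dotProduct_comm]
  simp

theorem eq_sum_eigenvectorBasis (hA : A.IsHermitian) (v : Fin n → ℝ) :
    v = ∑ j, ((hA.eigenvectorBasis j : Fin n → ℝ) ⬝ᵥ v) • (hA.eigenvectorBasis j : Fin n → ℝ) := by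
  have := congrArg WithLp.ofLp (hA.eigenvectorBasis.sum_repr' (WithLp.toLp 2 v))
  simp only [WithLp.ofLp_sum, WithLp.ofLp_smul] at this
  rw [← this]
  refine Finset.sum_congr rfl fun j _ => ?_
  rw [this, EuclideanSpace.inner_eq_star_dotProduct, dotProduct_comm]
  simp

/-- Parseval's identity for the eigenvector basis. -/
theorem dotProduct_eq_sum_eigenvectorBasis (hA : A.IsHermitian) (v w : Fin n → ℝ) :
    v ⬝ᵥ w = ∑ j, ((hA.eigenvectorBasis j : Fin n → ℝ) ⬝ᵥ v) *
      ((hA.eigenvectorBasis j : Fin n → ℝ) ⬝ᵥ w) := by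
  conv_lhs => rw [eq_sum_eigenvectorBasis hA v]
  rw [sum_dotProduct]
  simp [smul_dotProduct]

theorem eigenvectorBasis_dotProduct_mulVec (hA : A.IsHermitian) (j : Fin n) (v : Fin n → ℝ) :
    (hA.eigenvectorBasis j : Fin n → ℝ) ⬝ᵥ A *ᵥ v =
      hA.eigenvalues j * ((hA.eigenvectorBasis j : Fin n → ℝ) ⬝ᵥ v) := by
  have hT : Aᵀ = A := by simpa [conjTranspose_eq_transpose_of_trivial] using hA.eq
  rw [dotProduct_mulVec, ← mulVec_transpose, hT, hA.mulVec_eigenvectorBasis, smul_dotProduct]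
  rfl

theorem eigenvectorBasis_dotProduct_pow_mulVec (hA : A.IsHermitian) (j : Fin n) (k : ℕ)
    (v : Fin n → ℝ) :
    (hA.eigenvectorBasis j : Fin n → ℝ) ⬝ᵥ (A ^ k) *ᵥ v =
      hA.eigenvalues j ^ k * ((hA.eigenvectorBasis j : Fin n → ℝ) ⬝ᵥ v) := by
  induction k with
  | zero => simp
  | succ k ih =>
    rw [pow_succ', ← mulVec_mulVec, eigenvectorBasis_dotProduct_mulVec, ih]
    ring

/-- The moments of the spectral measure of `A` at `v`. -/
theorem dotProduct_pow_mulVec_eq_sum (hA : A.IsHermitian) (k : ℕ) (v : Fin n → ℝ) :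
    v ⬝ᵥ (A ^ k) *ᵥ v =
      ∑ j, ((hA.eigenvectorBasis j : Fin n → ℝ) ⬝ᵥ v) ^ 2 * hA.eigenvalues j ^ k := by
  rw [dotProduct_eq_sum_eigenvectorBasis hA]
  refine Finset.sum_congr rfl fun j _ => ?_
  rw [eigenvectorBasis_dotProduct_pow_mulVec]
  ring

/-- The Rayleigh quotient lies between bounds of the spectrum. -/
theorem dotProduct_mulVec_mem_Icc (hA : A.IsHermitian) {a b : ℝ}
    (hab : ∀ j, hA.eigenvalues j ∈ Set.Icc a b) (v : Fin n → ℝ) :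
    v ⬝ᵥ A *ᵥ v ∈ Set.Icc (a * (v ⬝ᵥ v)) (b * (v ⬝ᵥ v)) := by
  have h1 := dotProduct_pow_mulVec_eq_sum hA 1 v
  have h0 := dotProduct_pow_mulVec_eq_sum hA 0 v
  simp only [pow_one, pow_zero, one_mulVec, mul_one] at h1 h0
  rw [h1, h0, Finset.mul_sum, Finset.mul_sum]
  constructor <;> refine Finset.sum_le_sum fun j _ => ?_
  · rw [mul_comm]; exact mul_le_mul_of_nonneg_left (hab j).1 (sq_nonneg _)
  · rw [mul_comm b]; exact mul_le_mul_of_nonneg_left (hab j).2 (sq_nonneg _)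

end Spectral

/-! ### Lanczos iteration and Gauss quadrature -/

section Lanczos

variable {n : ℕ} (A : Matrix (Fin n) (Fin n) ℝ) (v : Fin n → ℝ)

theorem norm2_eq_zero {w : Fin n → ℝ} : norm2 w = 0 ↔ w = 0 := by
  rw [norm2, Real.sqrt_eq_zero (by simpa using dotProduct_star_self_nonneg w),
    dotProduct_self_eq_zero]

theorem norm2_smul_normalized (w : Fin n → ℝ) : norm2 w • normalized w = w := by
  by_cases h : w = 0
  · simp [h, normalized]
  · rw [normalized, smul_smul, mul_inv_cancel₀ (mt norm2_eq_zero.1 h), one_smul]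

theorem normalized_dotProduct_self {w : Fin n → ℝ} (hw : w ≠ 0) :
    normalized w ⬝ᵥ normalized w = 1 := by
  have h0 : norm2 w ≠ 0 := mt norm2_eq_zero.1 hw
  have h : w ⬝ᵥ w = norm2 w ^ 2 := by
    rw [norm2, Real.sq_sqrt (by simpa using dotProduct_star_self_nonneg w)]
  simp only [normalized, smul_dotProduct, dotProduct_smul, smul_eq_mul, h]
  field_simp

theorem dotProduct_normalized_eq_zero {x w : Fin n → ℝ} (h : x ⬝ᵥ w = 0) :
    x ⬝ᵥ normalized w = 0 := by
  rw [normalized, dotProduct_smul, h, smul_zero]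

theorem lanczosBeta_smul_lanczosVec (k : ℕ) :
    lanczosBeta A v k • lanczosVec A v k = lanczosResidual A v k :=
  norm2_smul_normalized _

theorem mulVec_lanczosVec_zero :
    A *ᵥ lanczosVec A v 0 =
      lanczosAlpha A v 0 • lanczosVec A v 0 + lanczosResidual A v 1 := by
  simp [lanczosResidual, lanczosVec, lanczosAlpha]

/-- The three-term recurrence. -/
theorem mulVec_lanczosVec_succ (k : ℕ) :
    A *ᵥ lanczosVec A v (k + 1) = lanczosBeta A v (k + 1) • lanczosVec A v k +
      lanczosAlpha A v (k + 1) • lanczosVec A v (k + 1) + lanczosResidual A v (k + 2) := by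
  simp only [lanczosResidual, lanczosVec, lanczosAlpha, lanczosBeta]
  abel

variable {A v}

theorem lanczosVec_dotProduct_self {k : ℕ} (h : lanczosResidual A v k ≠ 0) :
    lanczosVec A v k ⬝ᵥ lanczosVec A v k = 1 :=
  normalized_dotProduct_self h

theorem dotProduct_mulVec_comm (hA : A.IsHermitian) (x y : Fin n → ℝ) :
    x ⬝ᵥ A *ᵥ y = y ⬝ᵥ A *ᵥ x := by
  have hT : Aᵀ = A := by simpa [conjTranspose_eq_transpose_of_trivial] using hA.eq
  rw [dotProduct_mulVec, ← mulVec_transpose, hT, dotProduct_comm]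

/-- As long as no breakdown has occurred, each residual is orthogonal to all previous Lanczos
vectors. -/
theorem lanczosVec_dotProduct_lanczosResidual (hA : A.IsHermitian) (k : ℕ)
    (h : ∀ j < k, lanczosResidual A v j ≠ 0) (i : ℕ) (hi : i < k) :
    lanczosVec A v i ⬝ᵥ lanczosResidual A v k = 0 := by
  induction k using Nat.strong_induction_on generalizing i with
  | _ k ih =>
    have hvec : ∀ l < k, ∀ i < l, lanczosVec A v i ⬝ᵥ lanczosVec A v l = 0 := by
      intro l hl i hi
      have := ih l hl (fun j hj => h j (hj.trans hl)) i hi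
      exact dotProduct_normalized_eq_zero this
    match k, i, hi with
    | 1, 0, _ =>
      have h1 := mulVec_lanczosVec_zero A v
      have h2 := lanczosVec_dotProduct_self (h 0 one_pos)
      rw [← sub_eq_iff_eq_add'] at h1
      rw [← h1, dotProduct_sub, dotProduct_smul, h2, lanczosAlpha]
      simp
    | k + 2, i, hi =>
      have h1 := mulVec_lanczosVec_succ A v k
      rw [← sub_eq_iff_eq_add'] at h1
      have hu : ∀ j < k + 2, lanczosVec A v j ⬝ᵥ lanczosVec A v j = 1 :=
        fun j hj => lanczosVec_dotProduct_self (h j hj)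
      rw [← h1, dotProduct_sub, dotProduct_add, dotProduct_smul, dotProduct_smul]
      simp only [smul_eq_mul]
      rcases Nat.lt_succ_iff_lt_or_eq.1 hi with hi' | rfl
      -- For `i ≤ k`, symmetry moves `A` onto `vᵢ`. Of the terms of `A vᵢ` only the residual `i + 1`
      -- can meet `vₖ₊₁`, and it does so only for `i = k`, where it contributes the `βₖ₊₁` that the
      -- recurrence subtracts.
      · rw [hvec (k + 1) (by omega) i hi', dotProduct_mulVec_comm hA]
        have hres : lanczosVec A v (k + 1) ⬝ᵥ lanczosResidual A v (i + 1)
            = lanczosBeta A v (k + 1) * (lanczosVec A v i ⬝ᵥ lanczosVec A v k) := by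
          rcases Nat.lt_succ_iff_lt_or_eq.1 hi' with hik | rfl
          · rw [hvec k (by omega) i hik, ← lanczosBeta_smul_lanczosVec, dotProduct_smul,
              dotProduct_comm, hvec (k + 1) (by omega) (i + 1) (by omega)]
            simp
          · rw [hu i (by omega), ← lanczosBeta_smul_lanczosVec, dotProduct_smul,
              hu (i + 1) (by omega)]
            simp
        have hA' : lanczosVec A v (k + 1) ⬝ᵥ A *ᵥ lanczosVec A v i
            = lanczosVec A v (k + 1) ⬝ᵥ lanczosResidual A v (i + 1) := by
          have hki : lanczosVec A v (k + 1) ⬝ᵥ lanczosVec A v i = 0 := by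
            rw [dotProduct_comm]; exact hvec (k + 1) (by omega) i hi'
          cases i with
          | zero =>
            rw [mulVec_lanczosVec_zero, dotProduct_add, dotProduct_smul, hki]
            simp
          | succ i =>
            have hki' : lanczosVec A v (k + 1) ⬝ᵥ lanczosVec A v i = 0 := by
              rw [dotProduct_comm]; exact hvec (k + 1) (by omega) i (by omega)
            rw [mulVec_lanczosVec_succ, dotProduct_add, dotProduct_add, dotProduct_smul,
              dotProduct_smul, hki, hki']
            simp
        rw [hA', hres]
        ring
      · have hk : lanczosVec A v (k + 1) ⬝ᵥ lanczosVec A v k = 0 := by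
          rw [dotProduct_comm]; exact hvec (k + 1) (by omega) k (by omega)
        rw [hk, hu (k + 1) (by omega), lanczosAlpha]
        ring

theorem lanczosVec_orthonormal (hA : A.IsHermitian) {d : ℕ}
    (h : ∀ j ≤ d, lanczosResidual A v j ≠ 0) (i j : ℕ) (hi : i ≤ d) (hj : j ≤ d) :
    lanczosVec A v i ⬝ᵥ lanczosVec A v j = if i = j then 1 else 0 := by
  have key : ∀ l ≤ d, ∀ i < l, lanczosVec A v i ⬝ᵥ lanczosVec A v l = 0 := by
    intro l hl i hi
    have := lanczosVec_dotProduct_lanczosResidual hA l (fun j hj => h j (hj.le.trans hl)) i hi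
    exact dotProduct_normalized_eq_zero this
  split_ifs with hij
  · rw [hij]; exact lanczosVec_dotProduct_self (h j hj)
  · rcases lt_or_gt_of_ne hij with hlt | hlt
    · exact key j hj i hlt
    · rw [dotProduct_comm]; exact key i hi j hlt

variable (A v)

/-- The matrix whose columns are the Lanczos vectors `v₀, …, v_d`. -/
noncomputable def lanczosV (d : ℕ) : Matrix (Fin n) (Fin (d + 1)) ℝ :=
  Matrix.of fun i k => lanczosVec A v k i

theorem lanczosV_mulVec (d : ℕ) (x : Fin (d + 1) → ℝ) :
    lanczosV A v d *ᵥ x = ∑ k, x k • lanczosVec A v k := by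
  ext i
  simp [lanczosV, mulVec, dotProduct, mul_comm]

theorem lanczosT_apply_eq_sum (d : ℕ) (i j : Fin (d + 1)) :
    lanczosT A v d i j = (if (i : ℕ) = j then lanczosAlpha A v j else 0) +
      (if (i : ℕ) + 1 = j then lanczosBeta A v j else 0) +
      (if (i : ℕ) = j + 1 then lanczosBeta A v (j + 1) else 0) := by
  obtain ⟨i, hi⟩ := i
  obtain ⟨j, hj⟩ := j
  simp only [lanczosT, Matrix.of_apply]
  rcases eq_or_ne i j with rfl | h1
  · simp
  rcases eq_or_ne (i + 1) j with rfl | h2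
  · rw [if_neg h1, if_pos rfl, if_neg h1, if_pos rfl, if_neg (by omega), zero_add, add_zero]
  rcases eq_or_ne i (j + 1) with rfl | h3
  · simp only [if_neg h1, if_neg h2, if_true, zero_add]
  rw [if_neg h1, if_neg h2, if_neg h3.symm, if_neg h1, if_neg h2, if_neg h3, add_zero, add_zero]

/-- The column of `T` holds the coefficients of the three-term recurrence. Only the last column is
truncated: its subdiagonal entry would lie outside the matrix, and the residual is what is lost. -/
theorem lanczosV_mul_lanczosT_col (d : ℕ) (j : Fin (d + 1)) :
    ∑ i, lanczosT A v d i j • lanczosVec A v i = A *ᵥ lanczosVec A v j -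
      if (j : ℕ) = d then lanczosResidual A v (d + 1) else 0 := by
  simp only [lanczosT_apply_eq_sum, add_smul, Finset.sum_add_distrib, ite_smul, zero_smul]
  have h1 : ∑ i : Fin (d + 1), (if (i : ℕ) = j then lanczosAlpha A v j • lanczosVec A v i else 0)
      = lanczosAlpha A v j • lanczosVec A v j := by
    rw [Finset.sum_eq_single j]
    · simp
    · intro b _ hb
      rw [if_neg (by simpa [Fin.ext_iff] using hb)]
    · simp
  have h3 : ∑ i : Fin (d + 1),
      (if (i : ℕ) = j + 1 then lanczosBeta A v (j + 1) • lanczosVec A v i else 0)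
      = lanczosResidual A v (j + 1) - if (j : ℕ) = d then lanczosResidual A v (d + 1) else 0 := by
    by_cases hj : (j : ℕ) = d
    · rw [Finset.sum_eq_zero, if_pos hj, hj, sub_self]
      intro i _
      rw [if_neg (by omega)]
    · rw [Finset.sum_eq_single ⟨j + 1, by omega⟩]
      · simp [hj, lanczosBeta_smul_lanczosVec]
      · intro b _ hb
        rw [if_neg (by simpa [Fin.ext_iff] using hb)]
      · simp
  rw [h1, h3]
  obtain ⟨j, hj⟩ := j
  cases j with
  | zero =>
    rw [Finset.sum_eq_zero (fun i _ => by rw [if_neg (by simp)])]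
    simp only [mulVec_lanczosVec_zero]
    abel
  | succ j =>
    have h2 : ∑ i : Fin (d + 1),
        (if (i : ℕ) + 1 = j + 1 then lanczosBeta A v (j + 1) • lanczosVec A v i else 0)
        = lanczosBeta A v (j + 1) • lanczosVec A v j := by
      rw [Finset.sum_eq_single ⟨j, by omega⟩]
      · simp
      · intro b _ hb
        rw [if_neg (by simpa [Fin.ext_iff] using hb)]
      · simp
    simp only [h2, mulVec_lanczosVec_succ]
    abel

/-- The Lanczos relation `A V = V T + r e_dᵀ`. -/
theorem mulVec_lanczosV_mulVec (d : ℕ) (x : Fin (d + 1) → ℝ) :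
    A *ᵥ lanczosV A v d *ᵥ x = lanczosV A v d *ᵥ lanczosT A v d *ᵥ x +
      x (Fin.last d) • lanczosResidual A v (d + 1) := by
  have h2 : lanczosV A v d *ᵥ lanczosT A v d *ᵥ x
      = ∑ j, x j • ∑ i, lanczosT A v d i j • lanczosVec A v i := by
    rw [lanczosV_mulVec]
    simp only [mulVec, dotProduct, Finset.sum_smul, Finset.smul_sum, smul_smul]
    rw [Finset.sum_comm]
    simp only [mul_comm]
  rw [h2]
  simp only [lanczosV_mulVec, mulVec_sum, mulVec_smul, lanczosV_mul_lanczosT_col, smul_sub,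
    Finset.sum_sub_distrib]
  have h3 : ∑ j : Fin (d + 1), x j • (if (j : ℕ) = d then lanczosResidual A v (d + 1) else 0)
      = x (Fin.last d) • lanczosResidual A v (d + 1) := by
    rw [Finset.sum_eq_single (Fin.last d)]
    · simp
    · intro j _ hj
      rw [if_neg (by simpa [Fin.ext_iff] using hj), smul_zero]
    · simp
  rw [h3, sub_add_cancel]

variable {A v}

theorem lanczosV_mulVec_dotProduct (hA : A.IsHermitian) {d : ℕ}
    (h : ∀ j ≤ d, lanczosResidual A v j ≠ 0) (x y : Fin (d + 1) → ℝ) :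
    lanczosV A v d *ᵥ x ⬝ᵥ lanczosV A v d *ᵥ y = x ⬝ᵥ y := by
  simp only [lanczosV_mulVec, sum_dotProduct, dotProduct_sum, smul_dotProduct, dotProduct_smul,
    smul_eq_mul]
  simp_rw [fun i j : Fin (d + 1) =>
    lanczosVec_orthonormal hA h i j (Nat.lt_succ_iff.1 i.2) (Nat.lt_succ_iff.1 j.2)]
  simp [Fin.val_inj, dotProduct, mul_comm]

theorem lanczosV_mulVec_dotProduct_residual (hA : A.IsHermitian) {d : ℕ}
    (h : ∀ j ≤ d, lanczosResidual A v j ≠ 0) (x : Fin (d + 1) → ℝ) :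
    lanczosV A v d *ᵥ x ⬝ᵥ lanczosResidual A v (d + 1) = 0 := by
  rw [lanczosV_mulVec, sum_dotProduct]
  refine Finset.sum_eq_zero fun i _ => ?_
  rw [smul_dotProduct, lanczosVec_dotProduct_lanczosResidual hA (d + 1)
    (fun j hj => h j (Nat.lt_succ_iff.1 hj)) i i.2, smul_zero]

/-- `T` is the compression of `A` to the Krylov space. -/
theorem lanczosV_mulVec_dotProduct_mulVec (hA : A.IsHermitian) {d : ℕ}
    (h : ∀ j ≤ d, lanczosResidual A v j ≠ 0) (x y : Fin (d + 1) → ℝ) :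
    lanczosV A v d *ᵥ x ⬝ᵥ A *ᵥ lanczosV A v d *ᵥ y = x ⬝ᵥ lanczosT A v d *ᵥ y := by
  rw [mulVec_lanczosV_mulVec, dotProduct_add, lanczosV_mulVec_dotProduct hA h, dotProduct_smul,
    lanczosV_mulVec_dotProduct_residual hA h, smul_zero, add_zero]

/-- A tridiagonal matrix enlarges the support of a vector by at most one index per application. -/
theorem lanczosT_pow_mulVec_apply_eq_zero {d : ℕ} (k : ℕ) (i : Fin (d + 1)) (hi : k < i) :
    ((lanczosT A v d ^ k) *ᵥ Pi.single 0 1) i = 0 := by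
  induction k generalizing i with
  | zero =>
    rw [pow_zero, one_mulVec, Pi.single_eq_of_ne]
    exact fun h => by simp [h] at hi
  | succ k ih =>
    rw [pow_succ', ← mulVec_mulVec]
    rw [mulVec, dotProduct]
    refine Finset.sum_eq_zero fun j _ => ?_
    by_cases hj : k < j
    · rw [ih j hj, mul_zero]
    · rw [lanczosT_apply_eq_sum, if_neg (by omega), if_neg (by omega), if_neg (by omega)]
      simp

/-- The defect in `A V = V T + r e_dᵀ` acts only through the last coordinate, which is still zero
for powers of `T` below `d` applied to `e₀`. After a breakdown the defect vanishes and every power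
is allowed. -/
theorem pow_mulVec_lanczosV {d : ℕ} (k : ℕ) (hk : k ≤ d ∨ lanczosResidual A v (d + 1) = 0) :
    (A ^ k) *ᵥ lanczosV A v d *ᵥ Pi.single 0 1 =
      lanczosV A v d *ᵥ (lanczosT A v d ^ k) *ᵥ Pi.single 0 1 := by
  induction k with
  | zero => rw [pow_zero, pow_zero, one_mulVec, one_mulVec]
  | succ k ih =>
    rw [pow_succ', ← mulVec_mulVec, ih (hk.imp (by omega) id), mulVec_lanczosV_mulVec,
      pow_succ', ← mulVec_mulVec]
    rcases hk with hk | hk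
    · rw [lanczosT_pow_mulVec_apply_eq_zero k (Fin.last d) (by simpa using hk)]
      simp
    · simp [hk]

theorem dotProduct_pow_add_mulVec {k : ℕ} {B : Matrix (Fin k) (Fin k) ℝ} (hB : B.IsHermitian)
    (i j : ℕ) (x y : Fin k → ℝ) :
    x ⬝ᵥ (B ^ (i + j)) *ᵥ y = (B ^ i) *ᵥ x ⬝ᵥ (B ^ j) *ᵥ y := by
  have hT : (B ^ i)ᵀ = B ^ i := by
    simpa [conjTranspose_eq_transpose_of_trivial] using (hB.pow i).eq
  rw [pow_add, ← mulVec_mulVec, dotProduct_mulVec, ← mulVec_transpose, hT]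

/-- Moment matching for the Lanczos process. -/
theorem dotProduct_pow_mulVec_eq_lanczosT (hA : A.IsHermitian) {d : ℕ}
    (h : ∀ j ≤ d, lanczosResidual A v j ≠ 0) (k : ℕ)
    (hk : k ≤ 2 * d + 1 ∨ lanczosResidual A v (d + 1) = 0) :
    lanczosVec A v 0 ⬝ᵥ (A ^ k) *ᵥ lanczosVec A v 0 =
      Pi.single 0 1 ⬝ᵥ (lanczosT A v d ^ k) *ᵥ Pi.single 0 1 := by
  have h0 : lanczosVec A v 0 = lanczosV A v d *ᵥ Pi.single 0 1 := by
    ext i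
    simp [lanczosV]
  have hT := lanczosT_isHermitian A v d
  rw [h0]
  rcases hk with hk | hk
  · by_cases hkd : k ≤ d
    · rw [pow_mulVec_lanczosV k (Or.inl hkd), lanczosV_mulVec_dotProduct hA h]
    -- Put `d` factors on the left vector, `j ≤ d` on the right one, and leave one in the middle,
    -- where `T` is the compression of `A`. This central factor extends the range from `2d` to `2d +
    -- 1`.
    · obtain ⟨j, rfl⟩ : ∃ j, k = d + (1 + j) := ⟨k - d - 1, by omega⟩
      rw [dotProduct_pow_add_mulVec hA, dotProduct_pow_add_mulVec hT,
        pow_mulVec_lanczosV d (Or.inl le_rfl), pow_add, pow_one, ← mulVec_mulVec,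
        pow_mulVec_lanczosV j (Or.inl (by omega)), lanczosV_mulVec_dotProduct_mulVec hA h,
        pow_add, pow_one, ← mulVec_mulVec]
  · rw [pow_mulVec_lanczosV k (Or.inr hk), lanczosV_mulVec_dotProduct hA h]

/-- A node is the Rayleigh quotient of `T` at a unit eigenvector `q`, hence that of `A` at the unit
vector `V q`. -/
theorem lanczosNode_mem_Icc (hA : A.IsHermitian) {a b : ℝ}
    (hab : ∀ j, hA.eigenvalues j ∈ Set.Icc a b) {d : ℕ}
    (h : ∀ j ≤ d, lanczosResidual A v j ≠ 0) (k : Fin (d + 1)) :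
    lanczosNode A v d k ∈ Set.Icc a b := by
  have hT := lanczosT_isHermitian A v d
  set q : Fin (d + 1) → ℝ := (hT.eigenvectorBasis k).ofLp with hq
  have hqq : q ⬝ᵥ q = 1 := by simpa using eigenvectorBasis_dotProduct hT k k
  have hnode : q ⬝ᵥ lanczosT A v d *ᵥ q = lanczosNode A v d k := by
    rw [hq, hT.mulVec_eigenvectorBasis, dotProduct_smul, ← hq, hqq]
    simp [lanczosNode]
  have := dotProduct_mulVec_mem_Icc hA hab (lanczosV A v d *ᵥ q)
  rwa [lanczosV_mulVec_dotProduct_mulVec hA h, lanczosV_mulVec_dotProduct hA h, hqq, hnode,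
    mul_one, mul_one] at this

/-- The second alternative is a breakdown, in which case moment matching holds in all degrees; so
exactness up to degree `2m + 1` survives early stopping. -/
theorem lanczosSteps_spec (hv : v ≠ 0) (m : ℕ) :
    (∀ j ≤ lanczosSteps A v m, lanczosResidual A v j ≠ 0) ∧
      (lanczosSteps A v m = m ∨ lanczosResidual A v (lanczosSteps A v m + 1) = 0) := by
  classical
  have hP : ∀ j < lanczosSteps A v m, lanczosResidual A v (j + 1) ≠ 0 := by
    have := Nat.findGreatest_spec (P := fun k => ∀ j < k, lanczosResidual A v (j + 1) ≠ 0)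
      (Nat.zero_le m) (by simp)
    exact this
  refine ⟨?_, ?_⟩
  · intro j hj
    cases j with
    | zero => simpa [lanczosResidual] using hv
    | succ j => exact hP j hj
  · by_contra! hcon
    have hle : lanczosSteps A v m ≤ m := Nat.findGreatest_le m
    have hlt : lanczosSteps A v m + 1 ≤ m := by omega
    have : lanczosSteps A v m + 1 ≤ lanczosSteps A v m := by
      refine Nat.le_findGreatest hlt ?_
      intro j hj
      rcases Nat.lt_succ_iff_lt_or_eq.1 hj with hj | rfl
      · exact hP j hj
      · exact hcon.2
    omega

theorem lanczosWeight_sum_pow {d : ℕ} (k : ℕ) :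
    ∑ i, lanczosWeight A v d i * lanczosNode A v d i ^ k =
      Pi.single 0 1 ⬝ᵥ (lanczosT A v d ^ k) *ᵥ Pi.single 0 1 := by
  rw [dotProduct_pow_mulVec_eq_sum (lanczosT_isHermitian A v d)]
  simp [lanczosWeight, lanczosNode]

/-- Gauss quadrature is exact in degree at most `2m + 1`. -/
theorem lanczos_quadrature_exact (hA : A.IsHermitian) (hv : v ⬝ᵥ v = 1) (m : ℕ)
    (p : Polynomial ℝ) (hp : p.natDegree ≤ 2 * m + 1) :
    ∑ i, lanczosWeight A v (lanczosSteps A v m) i *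
        p.eval (lanczosNode A v (lanczosSteps A v m) i) =
      ∑ j, ((hA.eigenvectorBasis j : Fin n → ℝ) ⬝ᵥ v) ^ 2 * p.eval (hA.eigenvalues j) := by
  have hv0 : v ≠ 0 := by rintro rfl; simp at hv
  have hvec : lanczosVec A v 0 = v := by
    simp [lanczosVec, lanczosResidual, normalized, norm2, hv]
  obtain ⟨h1, h2⟩ := lanczosSteps_spec (A := A) hv0 m
  simp only [Polynomial.eval_eq_sum_range, Finset.mul_sum]
  rw [Finset.sum_comm, Finset.sum_comm (s := Finset.univ (α := Fin n))]
  refine Finset.sum_congr rfl fun k hk => ?_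
  have hk' : k ≤ 2 * m + 1 := by
    have := Finset.mem_range.1 hk
    omega
  have key := dotProduct_pow_mulVec_eq_lanczosT hA h1 k (h2.imp (fun h => by rwa [h]) id)
  rw [hvec, dotProduct_pow_mulVec_eq_sum hA, ← lanczosWeight_sum_pow] at key
  simp only [mul_left_comm _ (p.coeff k), ← Finset.mul_sum]
  rw [key]

/-- Error of the Lanczos quadrature in terms of uniform polynomial approximation. -/
theorem abs_lanczosQuadrature_sub_le (hA : A.IsHermitian) (hv : v ⬝ᵥ v = 1) {a b : ℝ}
    (hab : ∀ j, hA.eigenvalues j ∈ Set.Icc a b) (m : ℕ) {e : ℝ} {p : Polynomial ℝ}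
    (hp : p.natDegree ≤ 2 * m + 1) (hpe : ∀ t ∈ Set.Icc a b, |Real.log t - p.eval t| ≤ e) :
    |∑ j, ((hA.eigenvectorBasis j : Fin n → ℝ) ⬝ᵥ v) ^ 2 * Real.log (hA.eigenvalues j) -
      lanczosQuadrature A m v| ≤ 2 * e := by
  have hv0 : v ≠ 0 := by rintro rfl; simp at hv
  have hex := lanczos_quadrature_exact hA hv m p hp
  have hw1 : ∑ j, ((hA.eigenvectorBasis j : Fin n → ℝ) ⬝ᵥ v) ^ 2 = 1 := by
    have := dotProduct_pow_mulVec_eq_sum hA 0 v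
    simpa [hv] using this.symm
  have hw2 : ∑ i, lanczosWeight A v (lanczosSteps A v m) i = 1 := by
    have := lanczosWeight_sum_pow (A := A) (v := v) (d := lanczosSteps A v m) 0
    simpa using this
  have hnode := lanczosNode_mem_Icc hA hab (lanczosSteps_spec (A := A) hv0 m).1
  -- Stated for an arbitrary discrete probability measure on `[a, b]`: it serves both the spectral
  -- measure and the Gauss rule, which integrate `p` to the same value.
  have hsum : ∀ (k : ℕ) (w x : Fin k → ℝ), (∀ i, 0 ≤ w i) → ∑ i, w i = 1 →
      (∀ i, x i ∈ Set.Icc a b) →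
      |∑ i, w i * Real.log (x i) - ∑ i, w i * p.eval (x i)| ≤ e := by
    intro k w x hw hw1 hx
    rw [← Finset.sum_sub_distrib]
    refine (Finset.abs_sum_le_sum_abs _ _).trans ?_
    calc _ ≤ ∑ i, w i * e := by
          refine Finset.sum_le_sum fun i _ => ?_
          rw [← mul_sub, abs_mul, abs_of_nonneg (hw i)]
          exact mul_le_mul_of_nonneg_left (hpe _ (hx i)) (hw i)
      _ = e := by rw [← Finset.sum_mul, hw1, one_mul]
  have e1 := hsum n _ _ (fun j => sq_nonneg ((hA.eigenvectorBasis j : Fin n → ℝ) ⬝ᵥ v)) hw1 hab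
  have e2 := hsum _ (lanczosWeight A v (lanczosSteps A v m)) _ (fun i => sq_nonneg _) hw2 hnode
  rw [hex] at e2
  rw [lanczosQuadrature, two_mul]
  rw [abs_sub_comm] at e2
  refine (abs_sub_le _ _ _).trans (add_le_add e1 e2)

end Lanczos

/-! ### Exponential moments of squared Rademacher sums -/

section Probability

variable {Ω : Type*} [MeasurableSpace Ω] {P : Measure Ω}

/-- The blocks of an independent doubly indexed family are independent. -/
theorem iIndepFun_curry {ι κ E : Type*} [MeasurableSpace E] [IsProbabilityMeasure P]
    {X : ι → κ → Ω → E} (hX : ∀ i j, Measurable (X i j))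
    (h : iIndepFun (fun p : ι × κ => X p.1 p.2) P) :
    iIndepFun (fun i ω j => X i j ω) P := by
  have hp : ∀ i j, IsProbabilityMeasure (P.map (X i j)) :=
    fun i j => Measure.isProbabilityMeasure_map (hX i j).aemeasurable
  have h1 : ∀ i, iIndepFun (X i) P := fun i =>
    h.precomp (g := fun j => (i, j)) (fun a b hab => by simpa using hab)
  rw [iIndepFun_iff_map_fun_eq_infinitePi_map (fun i => by fun_prop)]
  have hcomp : (fun ω i j => X i j ω) =
      (MeasurableEquiv.curry ι κ E) ∘ (fun ω (p : ι × κ) => X p.1 p.2 ω) := rfl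
  rw [hcomp, ← Measure.map_map (by fun_prop) (by fun_prop),
    (iIndepFun_iff_map_fun_eq_infinitePi_map (X := fun p : ι × κ => X p.1 p.2)
      (fun p => hX p.1 p.2)).1 h,
    Measure.infinitePi_map_curry (fun i j => P.map (X i j))]
  congr 1
  ext1 i
  rw [(iIndepFun_iff_map_fun_eq_infinitePi_map (hX i)).1 (h1 i)]

theorem lintegral_exp_sq_gaussianReal {t : ℝ} (ht : t < 1 / 2) :
    ∫⁻ g, ENNReal.ofReal (Real.exp (t * g ^ 2)) ∂(gaussianReal 0 1) =
      ENNReal.ofReal (√(1 - 2 * t))⁻¹ := by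
  have hint : Integrable fun g : ℝ => Real.exp (-(1 / 2 - t) * g ^ 2) :=
    integrable_exp_neg_mul_sq (by linarith)
  rw [gaussianReal_of_var_ne_zero _ one_ne_zero,
    lintegral_withDensity_eq_lintegral_mul _ (measurable_gaussianPDF _ _) (by fun_prop)]
  have : ∀ g : ℝ, (gaussianPDF 0 1 * fun g => ENNReal.ofReal (Real.exp (t * g ^ 2))) g =
      ENNReal.ofReal ((√(2 * Real.pi))⁻¹ * Real.exp (-(1 / 2 - t) * g ^ 2)) := by
    intro g
    rw [Pi.mul_apply, gaussianPDF, ← ENNReal.ofReal_mul (gaussianPDFReal_nonneg _ _ _),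
      gaussianPDFReal, mul_assoc, ← Real.exp_add]
    congr 3
    · simp
    · simp only [NNReal.coe_one]; ring
  simp_rw [this]
  rw [← ofReal_integral_eq_lintegral_ofReal (hint.const_mul _)
    (Filter.Eventually.of_forall fun g => by positivity), integral_const_mul, integral_gaussian]
  congr 1
  rw [← Real.sqrt_inv, ← Real.sqrt_inv, ← Real.sqrt_mul (by positivity)]
  congr 1
  have h1 : (1 / 2 - t) ≠ 0 := by linarith
  have h2 : (1 - 2 * t) ≠ 0 := by linarith
  field_simp

/-- The exponential moment of the square of a sub-Gaussian variable. -/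
theorem integral_exp_mul_sq_le [IsProbabilityMeasure P] {X : Ω → ℝ} (hX : Measurable X)
    (hs : HasSubgaussianMGF X 1 P) {t : ℝ} (ht0 : 0 ≤ t) (ht : t < 1 / 2) :
    ∫ ω, Real.exp (t * X ω ^ 2) ∂P ≤ (√(1 - 2 * t))⁻¹ := by
  set c : ℝ := √(2 * t) with hc
  have hc2 : c ^ 2 = 2 * t := Real.sq_sqrt (by linarith)
  -- Linearize the square with an auxiliary standard Gaussian: `exp (t x²) = E exp (√(2t) x g)`.
  -- After Tonelli the sub-Gaussian bound applies for fixed `g`, and a Gaussian integral remains.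
  have hmgf : ∀ x : ℝ, ENNReal.ofReal (Real.exp (t * x ^ 2)) =
      ∫⁻ g, ENNReal.ofReal (Real.exp (c * x * g)) ∂(gaussianReal 0 1) := by
    intro x
    rw [← ofReal_integral_eq_lintegral_ofReal (integrable_exp_mul_gaussianReal _)
      (Filter.Eventually.of_forall fun g => (Real.exp_pos _).le)]
    have := congrFun (mgf_id_gaussianReal (μ := 0) (v := 1)) (c * x)
    rw [mgf] at this
    simp only [id] at this
    rw [this]
    congr 2
    simp only [NNReal.coe_one]
    linear_combination -(x ^ 2 / 2) * hc2
  rw [integral_eq_lintegral_of_nonneg_ae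
    (Filter.Eventually.of_forall fun ω => (Real.exp_pos _).le) (by fun_prop)]
  refine ENNReal.toReal_le_of_le_ofReal (by positivity) ?_
  calc ∫⁻ ω, ENNReal.ofReal (Real.exp (t * X ω ^ 2)) ∂P
      = ∫⁻ ω, ∫⁻ g, ENNReal.ofReal (Real.exp (c * X ω * g)) ∂(gaussianReal 0 1) ∂P := by
        simp_rw [hmgf]
    _ = ∫⁻ g, ∫⁻ ω, ENNReal.ofReal (Real.exp (c * X ω * g)) ∂P ∂(gaussianReal 0 1) :=
        lintegral_lintegral_swap (by fun_prop)
    _ ≤ ∫⁻ g, ENNReal.ofReal (Real.exp (t * g ^ 2)) ∂(gaussianReal 0 1) := by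
        refine lintegral_mono fun g => ?_
        have heq : ∀ ω, c * X ω * g = (c * g) * X ω := fun ω => by ring
        simp_rw [heq]
        rw [← ofReal_integral_eq_lintegral_ofReal (hs.integrable_exp_mul _)
          (Filter.Eventually.of_forall fun ω => (Real.exp_pos _).le)]
        refine ENNReal.ofReal_le_ofReal ((hs.mgf_le (c * g)).trans (Real.exp_le_exp.2 ?_))
        simp only [NNReal.coe_one]
        nlinarith [hc2]
    _ = _ := lintegral_exp_sq_gaussianReal ht

/-- Follows from `(1 - x + x²/2) (1 + x + x²/2) = 1 + x⁴/4 ≥ 1`. -/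
theorem exp_neg_le_quadratic {x : ℝ} (hx : 0 ≤ x) : Real.exp (-x) ≤ 1 - x + x ^ 2 / 2 := by
  have h := Real.quadratic_le_exp_of_nonneg hx
  have h2 : 0 < 1 - x + x ^ 2 / 2 := by nlinarith [sq_nonneg (x - 1)]
  rw [Real.exp_neg, inv_le_comm₀ (Real.exp_pos _) h2]
  refine le_trans ?_ h
  rw [inv_le_iff_one_le_mul₀ h2]
  nlinarith [sq_nonneg (x ^ 2)]

/-- A random sign. -/
structure IsRademacher (X : Ω → ℝ) (P : Measure Ω) : Prop where
  measurable : Measurable X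
  ae_eq : ∀ᵐ ω ∂P, X ω = 1 ∨ X ω = -1
  integral_eq_zero : ∫ ω, X ω ∂P = 0

theorem isRademacher_of_prob [IsProbabilityMeasure P] {X : Ω → ℝ} (hX : Measurable X)
    (h1 : P {ω | X ω = 1} = 1 / 2) (h2 : P {ω | X ω = -1} = 1 / 2) : IsRademacher X P := by
  have m1 : MeasurableSet {ω | X ω = 1} := hX (measurableSet_singleton 1)
  have m2 : MeasurableSet {ω | X ω = -1} := hX (measurableSet_singleton (-1))
  have hd : Disjoint {ω | X ω = 1} {ω | X ω = -1} := by
    rw [Set.disjoint_left]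
    intro ω h h'
    simp only [Set.mem_ofPred_eq] at h h'
    linarith
  have hae : ∀ᵐ ω ∂P, X ω = 1 ∨ X ω = -1 := by
    have : P ({ω | X ω = 1} ∪ {ω | X ω = -1}) = 1 := by
      rw [measure_union hd m2, h1, h2, ENNReal.add_halves]
    have := (prob_compl_eq_zero_iff (m1.union m2)).2 this
    exact this
  refine ⟨hX, hae, ?_⟩
  have heq : X =ᵐ[P] fun ω => Set.indicator {ω | X ω = 1} (fun _ => (1 : ℝ)) ω -
      Set.indicator {ω | X ω = -1} (fun _ => (1 : ℝ)) ω := by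
    filter_upwards [hae] with ω hω
    rcases hω with h | h <;> simp [Set.indicator, h] <;> norm_num
  rw [integral_congr_ae heq, integral_sub ((integrable_const 1).indicator m1)
    ((integrable_const 1).indicator m2), integral_indicator_const _ m1,
    integral_indicator_const _ m2, Measure.real, Measure.real, h1, h2]
  simp

theorem IsRademacher.hasSubgaussianMGF [IsProbabilityMeasure P] {X : Ω → ℝ}
    (h : IsRademacher X P) : HasSubgaussianMGF X 1 P := by
  have := hasSubgaussianMGF_of_mem_Icc_of_integral_eq_zero (a := -1) (b := 1)
    h.measurable.aemeasurable (by
      filter_upwards [h.ae_eq] with ω hω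
      rcases hω with h | h <;> rw [h] <;> norm_num) h.integral_eq_zero
  convert! this
  norm_num

section RademacherSum

variable {ι : Type*} {z : ι → Ω → ℝ}

theorem hasSubgaussianMGF_rademacher_sum [IsProbabilityMeasure P] [Fintype ι]
    (hz : ∀ i, IsRademacher (z i) P)
    (hind : iIndepFun z P) {u : ι → ℝ} (hu : ∑ i, u i ^ 2 = 1) :
    HasSubgaussianMGF (fun ω => ∑ i, u i * z i ω) 1 P := by
  have hi : iIndepFun (fun i ω => u i * z i ω) P :=
    hind.comp (fun i x => u i * x) (fun i => by fun_prop)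
  have := HasSubgaussianMGF.sum_of_iIndepFun hi (s := Finset.univ)
    (fun i _ => (hz i).hasSubgaussianMGF.const_mul (u i))
  convert! this
  apply NNReal.coe_injective
  push_cast
  rw [← hu]
  refine Finset.sum_congr rfl fun i _ => ?_
  exact (mul_one _).symm

theorem ae_abs_rademacher_sum_le [Finite ι] (hz : ∀ i, IsRademacher (z i) P) (s : Finset ι)
    (u : ι → ℝ) : ∀ᵐ ω ∂P, |∑ i ∈ s, u i * z i ω| ≤ ∑ i ∈ s, |u i| := by
  have : ∀ᵐ ω ∂P, ∀ i, z i ω = 1 ∨ z i ω = -1 := ae_all_iff.2 fun i => (hz i).ae_eq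
  filter_upwards [this] with ω hω
  refine (Finset.abs_sum_le_sum_abs _ _).trans (Finset.sum_le_sum fun i _ => ?_)
  rcases hω i with h | h <;> simp [h]

theorem integrable_pow_rademacher_sum [IsProbabilityMeasure P] [Finite ι]
    (hz : ∀ i, IsRademacher (z i) P) (s : Finset ι)
    (u : ι → ℝ) (k : ℕ) : Integrable (fun ω => (∑ i ∈ s, u i * z i ω) ^ k) P := by
  have hm : ∀ i, Measurable (z i) := fun i => (hz i).measurable
  refine Integrable.of_bound (C := (∑ i ∈ s, |u i|) ^ k) (by fun_prop) ?_
  filter_upwards [ae_abs_rademacher_sum_le hz s u] with ω hω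
  rw [norm_pow, Real.norm_eq_abs]
  gcongr

/-- The second and fourth moments of a Rademacher sum. -/
theorem integral_rademacher_sum_sq_and_pow_four [IsProbabilityMeasure P] [Finite ι]
    (hz : ∀ i, IsRademacher (z i) P)
    (hind : iIndepFun z P) (u : ι → ℝ) (s : Finset ι) :
    ∫ ω, (∑ i ∈ s, u i * z i ω) ^ 2 ∂P = ∑ i ∈ s, u i ^ 2 ∧
      ∫ ω, (∑ i ∈ s, u i * z i ω) ^ 4 ∂P ≤ 3 * (∑ i ∈ s, u i ^ 2) ^ 2 := by
  classical
  have hm : ∀ i, Measurable (z i) := fun i => (hz i).measurable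
  induction s using Finset.induction_on with
  | empty => simp
  | insert a s ha ih =>
    set S : Ω → ℝ := fun ω => ∑ i ∈ s, u i * z i ω with hS
    have hSm : Measurable S := by fun_prop
    have hint : ∀ k, Integrable (fun ω => S ω ^ k) P := integrable_pow_rademacher_sum hz s u
    change ∫ ω, S ω ^ 2 ∂P = _ ∧ ∫ ω, S ω ^ 4 ∂P ≤ _ at ih
    have hi : iIndepFun (fun i ω => u i * z i ω) P :=
      hind.comp (fun i x => u i * x) (fun i => by fun_prop)
    have hSz : IndepFun S (fun ω => u a * z a ω) P := by
      have := hi.indepFun_finsetSum_of_notMem (fun i => by fun_prop) ha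
      convert! this using 1
      ext ω
      simp [hS]
    -- The new sign is centred and independent of `S`, so the terms odd in it drop out of both
    -- expansions.
    have hodd : ∀ k : ℕ, ∫ ω, S ω ^ k * (u a * z a ω) ∂P = 0 := by
      intro k
      have hk : IndepFun (fun ω => S ω ^ k) (fun ω => u a * z a ω) P :=
        hSz.comp (φ := fun x => x ^ k) (ψ := id) (by fun_prop) measurable_id
      rw [hk.integral_fun_mul_eq_mul_integral (by fun_prop) (by fun_prop), integral_const_mul,
        (hz a).integral_eq_zero]
      simp
    have hintodd : ∀ k : ℕ, Integrable (fun ω => S ω ^ k * (u a * z a ω)) P := by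
      intro k
      refine (hint k).mul_bdd (c := |u a|) (by fun_prop) ?_
      filter_upwards [(hz a).ae_eq] with ω hω
      rcases hω with h | h <;> simp [h]
    have hsq : ∀ᵐ ω ∂P, z a ω ^ 2 = 1 := by
      filter_upwards [(hz a).ae_eq] with ω hω
      rcases hω with h | h <;> simp [h]
    have h2 : (fun ω => (∑ i ∈ insert a s, u i * z i ω) ^ 2) =ᵐ[P]
        fun ω => S ω ^ 2 + 2 * (S ω ^ 1 * (u a * z a ω)) + u a ^ 2 := by
      filter_upwards [hsq] with ω hω
      rw [Finset.sum_insert ha]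
      linear_combination u a ^ 2 * hω
    have h4 : (fun ω => (∑ i ∈ insert a s, u i * z i ω) ^ 4) =ᵐ[P]
        fun ω => S ω ^ 4 + 4 * (S ω ^ 3 * (u a * z a ω)) + 6 * u a ^ 2 * S ω ^ 2 +
          4 * u a ^ 2 * (S ω ^ 1 * (u a * z a ω)) + u a ^ 4 := by
      filter_upwards [hsq] with ω hω
      rw [Finset.sum_insert ha]
      linear_combination (6 * u a ^ 2 * S ω ^ 2 + 4 * u a ^ 3 * S ω * z a ω +
        u a ^ 4 * (z a ω ^ 2 + 1)) * hω
    rw [Finset.sum_insert ha]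
    constructor
    · rw [integral_congr_ae h2, integral_add (((hint 2).fun_add ((hintodd 1).const_mul 2)))
        (integrable_const _), integral_add (hint 2) ((hintodd 1).const_mul 2),
        integral_const_mul, hodd, ih.1]
      simp
      ring
    · rw [integral_congr_ae h4, integral_add ((((hint 4).fun_add ((hintodd 3).const_mul 4)).fun_add
          ((hint 2).const_mul _)).fun_add ((hintodd 1).const_mul _)) (integrable_const _),
        integral_add (((hint 4).fun_add ((hintodd 3).const_mul 4)).fun_add
          ((hint 2).const_mul _)) ((hintodd 1).const_mul _),
        integral_add ((hint 4).fun_add ((hintodd 3).const_mul 4)) ((hint 2).const_mul _),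
        integral_add (hint 4) ((hintodd 3).const_mul 4),
        integral_const_mul, hodd, integral_const_mul, ih.1, integral_const_mul, hodd]
      simp
      nlinarith [ih.2, sq_nonneg (u a ^ 2)]

/-- For the lower tail, moments suffice: the quadratic bound on `exp (-x)` involves only `E X² = 1`
and `E X⁴ ≤ 3`. -/
theorem integral_exp_neg_mul_sq_rademacher_sum_le [IsProbabilityMeasure P] [Fintype ι]
    (hz : ∀ i, IsRademacher (z i) P)
    (hind : iIndepFun z P) {u : ι → ℝ} (hu : ∑ i, u i ^ 2 = 1) {t : ℝ} (ht : 0 ≤ t) :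
    ∫ ω, Real.exp (-t * (∑ i, u i * z i ω) ^ 2) ∂P ≤ Real.exp (-t + 3 / 2 * t ^ 2) := by
  have hm : ∀ i, Measurable (z i) := fun i => (hz i).measurable
  have hint := integrable_pow_rademacher_sum hz Finset.univ u
  obtain ⟨h2, h4⟩ := integral_rademacher_sum_sq_and_pow_four hz hind u Finset.univ
  rw [hu] at h2 h4
  have hexp : Integrable (fun ω => Real.exp (-t * (∑ i, u i * z i ω) ^ 2)) P := by
    refine Integrable.of_bound (C := 1) (by fun_prop) (Filter.Eventually.of_forall fun ω => ?_)
    rw [Real.norm_eq_abs, Real.abs_exp, Real.exp_le_one_iff]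
    nlinarith [sq_nonneg (∑ i, u i * z i ω), mul_nonneg ht (sq_nonneg (∑ i, u i * z i ω))]
  have hlin : Integrable (fun ω => 1 - t * (∑ i, u i * z i ω) ^ 2) P :=
    (integrable_const 1).sub ((hint 2).const_mul t)
  have hint' : Integrable (fun ω => 1 - t * (∑ i, u i * z i ω) ^ 2 +
      t ^ 2 / 2 * (∑ i, u i * z i ω) ^ 4) P :=
    hlin.fun_add ((hint 4).const_mul _)
  calc _ ≤ ∫ ω, (1 - t * (∑ i, u i * z i ω) ^ 2 + t ^ 2 / 2 * (∑ i, u i * z i ω) ^ 4) ∂P := by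
        refine integral_mono hexp hint' fun ω => ?_
        have := exp_neg_le_quadratic (mul_nonneg ht (sq_nonneg (∑ i, u i * z i ω)))
        simp only
        rw [neg_mul]
        refine this.trans (le_of_eq (by ring))
    _ = 1 - t + t ^ 2 / 2 * ∫ ω, (∑ i, u i * z i ω) ^ 4 ∂P := by
        rw [integral_add hlin ((hint 4).const_mul _),
          integral_sub (integrable_const 1) ((hint 2).const_mul t), integral_const_mul,
          integral_const_mul, h2]
        simp
    _ ≤ (-t + 3 / 2 * t ^ 2) + 1 := by nlinarith [sq_nonneg t]
    _ ≤ _ := Real.add_one_le_exp _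

end RademacherSum

end Probability

/-! ### Concentration of Hutchinson's estimator -/

section Hutchinson

variable {Ω : Type*} [MeasurableSpace Ω] {P : Measure Ω} {N n : ℕ}
  {z : Fin N → Fin n → Ω → ℝ}

theorem IsRademacherFamily.isRademacher [IsProbabilityMeasure P]
    (hz : IsRademacherFamily P z) (i : Fin N) (j : Fin n) :
    IsRademacher (z i j) P :=
  isRademacher_of_prob (hz.measurable i j) (hz.prob_one i j) (hz.prob_neg_one i j)

theorem IsRademacherFamily.iIndepFun_row (hz : IsRademacherFamily P z) (i : Fin N) :
    iIndepFun (z i) P :=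
  hz.indep.precomp (g := fun j => (i, j)) (fun a b hab => by simpa using hab)

/-- The exponential moment of a convex combination of squares of Rademacher sums. -/
theorem mgf_sum_mul_sq_le [IsProbabilityMeasure P] {ι κ : Type*} [Fintype ι] [Fintype κ]
    {z : κ → Ω → ℝ} (hz : ∀ l, IsRademacher (z l) P) (u : ι → κ → ℝ) {w : ι → ℝ}
    (hw0 : ∀ j, 0 ≤ w j)
    (hw1 : ∑ j, w j = 1) {s C : ℝ}
    (hC : ∀ j, ∫ ω, Real.exp (s * (∑ l, u j l * z l ω) ^ 2) ∂P ≤ C) :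
    Integrable (fun ω => Real.exp (s * ∑ j, w j * (∑ l, u j l * z l ω) ^ 2)) P ∧
      mgf (fun ω => ∑ j, w j * (∑ l, u j l * z l ω) ^ 2) P s ≤ C := by
  have hm : ∀ l, Measurable (z l) := fun l => (hz l).measurable
  have hbd : ∀ᵐ ω ∂P, ∀ j, |∑ l, u j l * z l ω| ≤ ∑ l, |u j l| :=
    ae_all_iff.2 fun j => ae_abs_rademacher_sum_le hz Finset.univ (u j)
  have hsq : ∀ᵐ ω ∂P, ∀ j, (∑ l, u j l * z l ω) ^ 2 ∈ Set.Icc 0 ((∑ l, |u j l|) ^ 2) := by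
    filter_upwards [hbd] with ω hω j
    exact ⟨sq_nonneg _, sq_le_sq' (abs_le.1 (hω j)).1 (abs_le.1 (hω j)).2⟩
  have hint1 : ∀ j, Integrable (fun ω => Real.exp (s * (∑ l, u j l * z l ω) ^ 2)) P := fun j =>
    integrable_exp_mul_of_mem_Icc (by fun_prop) (hsq.mono fun ω h => h j)
  have hint : Integrable (fun ω => Real.exp (s * ∑ j, w j * (∑ l, u j l * z l ω) ^ 2)) P := by
    refine integrable_exp_mul_of_mem_Icc (a := 0) (b := ∑ j, w j * (∑ l, |u j l|) ^ 2)
      (by fun_prop) ?_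
    filter_upwards [hsq] with ω hω
    exact ⟨Finset.sum_nonneg fun j _ => mul_nonneg (hw0 j) (hω j).1,
      Finset.sum_le_sum fun j _ => mul_le_mul_of_nonneg_left (hω j).2 (hw0 j)⟩
  refine ⟨hint, ?_⟩
  calc mgf (fun ω => ∑ j, w j * (∑ l, u j l * z l ω) ^ 2) P s
      ≤ ∫ ω, ∑ j, w j * Real.exp (s * (∑ l, u j l * z l ω) ^ 2) ∂P := by
        refine integral_mono hint (integrable_finsetSum _ fun j _ => (hint1 j).const_mul _)
          fun ω => ?_
        have := convexOn_exp.map_sum_le (t := Finset.univ) (w := w)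
          (p := fun j => s * (∑ l, u j l * z l ω) ^ 2) (fun j _ => hw0 j) hw1
          (fun j _ => Set.mem_univ _)
        simp only [smul_eq_mul] at this
        refine le_trans (le_of_eq ?_) this
        congr 1
        rw [Finset.mul_sum]
        exact Finset.sum_congr rfl fun j _ => by ring
    _ = ∑ j, w j * ∫ ω, Real.exp (s * (∑ l, u j l * z l ω) ^ 2) ∂P := by
        rw [integral_finsetSum _ fun j _ => (hint1 j).const_mul _]
        simp_rw [integral_const_mul]
    _ ≤ ∑ j, w j * C := Finset.sum_le_sum fun j _ => mul_le_mul_of_nonneg_left (hC j) (hw0 j)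
    _ = C := by rw [← Finset.sum_mul, hw1, one_mul]

/-- Amounts to `log (1 + δ) ≤ δ - δ²/3`. The quadratic lower bound for `exp` proves it once `(1 -
δ/3)² ≥ 2/3`, which at `δ = 1/2` reads `25/36 ≥ 24/36`. -/
theorem exp_neg_half_mul_sqrt_le {δ : ℝ} (hδ0 : 0 ≤ δ) (hδ : δ ≤ 1 / 2) :
    Real.exp (-(δ / 2)) * √(1 + δ) ≤ Real.exp (-(δ ^ 2 / 6)) := by
  have h1 : 1 + δ ≤ Real.exp (δ - δ ^ 2 / 3) := by
    refine le_trans ?_ (Real.quadratic_le_exp_of_nonneg (by nlinarith))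
    nlinarith [mul_nonneg (sq_nonneg δ) (by nlinarith : (0 : ℝ) ≤ (1 - δ / 3) ^ 2 - 2 / 3)]
  have h2 : √(1 + δ) ≤ Real.exp (δ / 2 - δ ^ 2 / 6) := by
    rw [Real.sqrt_le_left (Real.exp_pos _).le, ← Real.exp_nat_mul]
    refine h1.trans (le_of_eq ?_)
    congr 1
    push_cast
    ring
  calc _ ≤ Real.exp (-(δ / 2)) * Real.exp (δ / 2 - δ ^ 2 / 6) := by gcongr
    _ = _ := by rw [← Real.exp_add]; congr 1; ring

/-- Concentration of Hutchinson's estimator for a positive semidefinite matrix of trace `1` with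
eigenvalues `w` and eigenvectors `u`. -/
theorem hutchinson_concentration [IsProbabilityMeasure P] (hz : IsRademacherFamily P z)
    {ι : Type*} [Fintype ι]
    {u : ι → Fin n → ℝ} (hu : ∀ j, ∑ l, u j l ^ 2 = 1) {w : ι → ℝ} (hw0 : ∀ j, 0 ≤ w j)
    (hw1 : ∑ j, w j = 1) {δ : ℝ} (hδ0 : 0 < δ) (hδ : δ ≤ 1 / 2) :
    P.real {ω | N * δ ≤ |∑ i, ∑ j, w j * (∑ l, u j l * z i l ω) ^ 2 - N|} ≤
      2 * Real.exp (-(N * δ ^ 2 / 6)) := by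
  have hzr := hz.isRademacher
  have hm : ∀ i l, Measurable (z i l) := hz.measurable
  set Y : Fin N → Ω → ℝ := fun i ω => ∑ j, w j * (∑ l, u j l * z i l ω) ^ 2 with hY
  have hYm : ∀ i, Measurable (Y i) := fun i => by fun_prop
  have hYind : iIndepFun Y P :=
    (iIndepFun_curry hm hz.indep).comp (fun _ x => ∑ j, w j * (∑ l, u j l * x l) ^ 2)
      (fun _ => by fun_prop)
  have hmgf : ∀ {s C : ℝ},
      (∀ i j, ∫ ω, Real.exp (s * (∑ l, u j l * z i l ω) ^ 2) ∂P ≤ C) →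
      Integrable (fun ω => Real.exp (s * (∑ i, Y i) ω)) P ∧ mgf (∑ i, Y i) P s ≤ C ^ N := by
    intro s C hC
    have h := fun i => mgf_sum_mul_sq_le (hzr i) u hw0 hw1 (hC i)
    refine ⟨hYind.integrable_exp_mul_sum hYm fun i _ => (h i).1, ?_⟩
    rw [hYind.mgf_sum hYm]
    calc _ ≤ ∏ _i : Fin N, C := Finset.prod_le_prod (fun _ _ => mgf_nonneg) fun i _ => (h i).2
      _ = C ^ N := by simp
  have hup : P.real {ω | N * (1 + δ) ≤ (∑ i, Y i) ω} ≤ Real.exp (-(N * δ ^ 2 / 6)) := by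
    -- The minimizer of `exp (-t (1 + δ)) / √(1 - 2t)`, characterized by `1 - 2t = 1 / (1 + δ)`.
    set t : ℝ := δ / (2 * (1 + δ)) with ht
    have ht0 : 0 ≤ t := by positivity
    have htd : t * (1 + δ) = δ / 2 := by rw [ht]; field_simp
    have ht2 : 1 - 2 * t = (1 + δ)⁻¹ := by rw [ht]; field_simp; ring
    have ht1 : t < 1 / 2 := by
      have : 0 < 1 - 2 * t := by rw [ht2]; positivity
      linarith
    obtain ⟨hi, hle⟩ := hmgf (s := t) (C := √(1 + δ)) fun i j => by
      have := integral_exp_mul_sq_le (by fun_prop)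
        (hasSubgaussianMGF_rademacher_sum (hzr i) (hz.iIndepFun_row i) (hu j)) ht0 ht1
      rwa [ht2, Real.sqrt_inv, inv_inv] at this
    refine (measure_ge_le_exp_mul_mgf _ ht0 hi).trans ?_
    calc _ ≤ Real.exp (-t * (N * (1 + δ))) * √(1 + δ) ^ N := by gcongr
      _ = (Real.exp (-(δ / 2)) * √(1 + δ)) ^ N := by
          rw [mul_pow, ← Real.exp_nat_mul]
          congr 2
          linear_combination -(N : ℝ) * htd
      _ ≤ Real.exp (-(δ ^ 2 / 6)) ^ N := by
          gcongr
          exact exp_neg_half_mul_sqrt_le hδ0.le hδ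
      _ = _ := by
          rw [← Real.exp_nat_mul]
          congr 1
          ring
  have hlow : P.real {ω | (∑ i, Y i) ω ≤ N * (1 - δ)} ≤ Real.exp (-(N * δ ^ 2 / 6)) := by
    -- With `s = -t` the exponent per sample is `-t δ + 3 t² / 2`, minimal at `t = δ / 3` with value
    -- `-δ² / 6`.
    obtain ⟨hi, hle⟩ := hmgf (s := -(δ / 3)) fun i j =>
      integral_exp_neg_mul_sq_rademacher_sum_le (hzr i) (hz.iIndepFun_row i) (hu j)
        (by positivity : 0 ≤ δ / 3)
    refine (measure_le_le_exp_mul_mgf _ (by linarith) hi).trans ?_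
    calc _ ≤ _ := mul_le_mul_of_nonneg_left hle (Real.exp_pos _).le
      _ = _ := by
          rw [← Real.exp_nat_mul, ← Real.exp_add]
          congr 1
          ring
  have hsub : {ω | N * δ ≤ |∑ i, Y i ω - N|} ⊆
      {ω | N * (1 + δ) ≤ (∑ i, Y i) ω} ∪ {ω | (∑ i, Y i) ω ≤ N * (1 - δ)} := by
    intro ω hω
    simp only [Set.mem_union, Set.mem_ofPred_eq, Finset.sum_apply] at hω ⊢
    rcases le_abs.1 hω with h | h
    · left; linarith
    · right; linarith
  calc _ ≤ _ := measureReal_mono hsub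
    _ ≤ _ := measureReal_union_le _ _
    _ ≤ _ := by linarith

end Hutchinson

end SLQ

/-! ### Assembly of the two error bounds -/

theorem theorem3p9 {n : ℕ} (A : Matrix (Fin n) (Fin n) ℝ) (hA : A.PosDef)
    (lmin lmax κ : ℝ)
    (hmin : IsLeast (spectrum ℝ A) lmin) (hmax : IsGreatest (spectrum ℝ A) lmax)
    (hlt : lmin < lmax) (hmax1 : lmax < 1) (hκ : κ = lmax / lmin)
    (ε η : ℝ) (hε : ε ∈ Set.Ioo (0 : ℝ) 1) (hη : η ∈ Set.Ioo (0 : ℝ) 1)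
    (m N : ℕ)
    (hm : 1 / (2 * Real.log (SLQ.rho2 lmin lmax)) *
        Real.log (SLQ.Krho2 lmin lmax / (ε * Real.log (κ ^ (1 / (n : ℝ)) / lmax))) ≤ (m : ℝ))
    (hN : 24 / ε ^ 2 * Real.log (2 / η) ≤ (N : ℝ))
    {Ω : Type*} [MeasurableSpace Ω] (P : Measure Ω) [IsProbabilityMeasure P]
    (z : Fin N → Fin n → Ω → ℝ) (hz : SLQ.IsRademacherFamily P z) :
    1 - η ≤ P.real {ω | |Real.log A.det - SLQ.slqLogDet A m N (fun i j => z i j ω)|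
      ≤ ε * |Real.log A.det|} := by
  obtain ⟨hε0, hε1⟩ := hε
  obtain ⟨hη0, hη1⟩ := hη
  have hH : A.IsHermitian := hA.1
  have hspec := hH.spectrum_real_eq_range_eigenvalues
  have heig : ∀ j, hH.eigenvalues j ∈ Set.Icc lmin lmax := fun j =>
    ⟨hmin.2 (hH.eigenvalues_mem_spectrum_real j), hmax.2 (hH.eigenvalues_mem_spectrum_real j)⟩
  obtain ⟨j0, hj0⟩ : ∃ j, hH.eigenvalues j = lmin := by
    have := hmin.1
    rw [hspec] at this
    exact this
  have hmin0 : 0 < lmin := hj0 ▸ hA.eigenvalues_pos j0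
  have hmax0 : 0 < lmax := hmin0.trans hlt
  have hn : 0 < n := Fin.pos j0
  have hn' : (0 : ℝ) < n := by exact_mod_cast hn
  have hNpos : (0 : ℝ) < N := by
    refine lt_of_lt_of_le ?_ hN
    have : 0 < Real.log (2 / η) := Real.log_pos (by rw [one_lt_div hη0]; linarith)
    positivity
  set W : ℝ := ∑ j, -Real.log (hH.eigenvalues j) with hW
  have hlogpos : ∀ j, 0 < -Real.log (hH.eigenvalues j) := fun j => by
    have := Real.log_neg (hA.eigenvalues_pos j) ((heig j).2.trans_lt hmax1)
    linarith
  have hWdet : Real.log A.det = -W := by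
    rw [hH.det_eq_prod_eigenvalues]
    simp only [RCLike.ofReal_real_eq_id, id]
    rw [Real.log_prod fun j _ => (hA.eigenvalues_pos j).ne', hW, Finset.sum_neg_distrib, neg_neg]
  have hWpos : 0 < W := Finset.sum_pos (fun j _ => hlogpos j) ⟨j0, Finset.mem_univ _⟩
  set L : ℝ := Real.log (κ ^ (1 / (n : ℝ)) / lmax) with hL
  have hκ0 : 0 < κ := by rw [hκ]; positivity
  have hL' : n * L = -Real.log lmin - (n - 1) * Real.log lmax := by
    rw [hL, Real.log_div (Real.rpow_pos_of_pos hκ0 _).ne' hmax0.ne', Real.log_rpow hκ0, hκ,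
      Real.log_div hmax0.ne' hmin0.ne']
    field_simp
    ring
  -- One eigenvalue equals `lmin`; each of the other `n - 1` contributes at least `-log lmax`. This
  -- is what `κ ^ (1/n) / lmax` encodes.
  have hLW : n * L ≤ W := by
    rw [hL', hW, ← Finset.add_sum_erase _ _ (Finset.mem_univ j0), hj0]
    have : ∑ j ∈ Finset.univ.erase j0, -Real.log lmax
        ≤ ∑ j ∈ Finset.univ.erase j0, -Real.log (hH.eigenvalues j) :=
      Finset.sum_le_sum fun j _ => neg_le_neg (Real.log_le_log (hA.eigenvalues_pos j) (heig j).2)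
    rw [Finset.sum_const, Finset.card_erase_of_mem (Finset.mem_univ _), Finset.card_univ,
      Fintype.card_fin, nsmul_eq_mul, Nat.cast_sub hn] at this
    push_cast at this
    linarith
  have hLpos : 0 < L := by
    have h1 := Real.log_neg hmin0 (hlt.trans hmax1)
    have h2 := Real.log_neg hmax0 hmax1
    have h3 : (1 : ℝ) ≤ n := by exact_mod_cast hn
    have : 0 < n * L := by rw [hL']; nlinarith
    exact pos_of_mul_pos_right this hn'.le
  set ρ := SLQ.rho2 lmin lmax with hρ
  have hρ1 : 1 < ρ := SLQ.one_lt_rho2 hmin0 hlt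
  have hρ2 : 0 < ρ ^ 2 - ρ := by nlinarith
  obtain ⟨p, hpdeg, hp⟩ := SLQ.exists_polynomial_log hmin0 hlt m
  rw [← hρ] at hp
  set e : ℝ := 1 / (ρ ^ 2 - ρ) / ρ ^ (2 * m) with he
  have hK : 4 / (ρ ^ 2 - ρ) ≤ SLQ.Krho2 lmin lmax := by
    have hM : 1 ≤ SLQ.Mrho2 lmin := by
      rw [SLQ.Mrho2, Real.le_sqrt' one_pos]
      nlinarith [Real.pi_gt_three, sq_nonneg (Real.log (lmin / 2))]
    rw [SLQ.Krho2, ← hρ]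
    gcongr
    linarith
  have hKpos : 0 < SLQ.Krho2 lmin lmax := lt_of_lt_of_le (by positivity) hK
  have hKρ : SLQ.Krho2 lmin lmax ≤ ε * L * ρ ^ (2 * m) := by
    have hlogρ : 0 < Real.log ρ := Real.log_pos hρ1
    rw [one_div_mul_eq_div, div_le_iff₀ (by positivity)] at hm
    rw [← div_le_iff₀' (by positivity), ← Real.log_le_log_iff (by positivity) (by positivity),
      Real.log_pow]
    push_cast
    linarith
  have he4 : 4 * e ≤ ε * L := by
    have : 4 * e = 4 / (ρ ^ 2 - ρ) / ρ ^ (2 * m) := by rw [he]; ring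
    rw [this, div_le_iff₀ (by positivity)]
    exact hK.trans hKρ
  have heW : n * (2 * e) ≤ ε / 2 * W := by
    have h1 : n * (4 * e) ≤ n * (ε * L) := mul_le_mul_of_nonneg_left he4 hn'.le
    have h2 : ε * (n * L) ≤ ε * W := mul_le_mul_of_nonneg_left hLW hε0.le
    linarith
  have hu : ∀ j, ∑ l, (hH.eigenvectorBasis j : Fin n → ℝ) l ^ 2 = 1 := fun j => by
    have := SLQ.eigenvectorBasis_dotProduct hH j j
    simpa [dotProduct, sq] using this
  -- Dividing by the trace `W` makes the weights convex. The choice `δ = ε / 2` turns `δ² / 6` into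
  -- `ε² / 24`, the source of the constant in the bound on `N`.
  have hconc := SLQ.hutchinson_concentration hz hu
    (w := fun j => -Real.log (hH.eigenvalues j) / W)
    (fun j => (div_pos (hlogpos j) hWpos).le)
    (by rw [← Finset.sum_div, ← hW, div_self hWpos.ne'])
    (δ := ε / 2) (by linarith) (by linarith)
  have hexp : 2 * Real.exp (-(N * (ε / 2) ^ 2 / 6)) ≤ η := by
    have h1 : Real.log (2 / η) ≤ N * (ε / 2) ^ 2 / 6 := by
      have := mul_le_mul_of_nonneg_left hN (by positivity : 0 ≤ ε ^ 2 / 24)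
      calc Real.log (2 / η) = ε ^ 2 / 24 * (24 / ε ^ 2 * Real.log (2 / η)) := by field_simp
        _ ≤ _ := this
        _ = _ := by ring
    have h2 : Real.exp (-(N * (ε / 2) ^ 2 / 6)) ≤ Real.exp (-Real.log (2 / η)) :=
      Real.exp_le_exp.2 (neg_le_neg h1)
    rw [Real.exp_neg (Real.log _), Real.exp_log (by positivity), inv_div] at h2
    linarith
  set bad := {ω | N * (ε / 2) ≤ |∑ i, ∑ j, -Real.log (hH.eigenvalues j) / W *
    (∑ l, (hH.eigenvectorBasis j : Fin n → ℝ) l * z i l ω) ^ 2 - N|} with hbad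
  set good := {ω | |Real.log A.det - SLQ.slqLogDet A m N (fun i j => z i j ω)|
      ≤ ε * |Real.log A.det|} with hgood
  have hsign : ∀ᵐ ω ∂P, ∀ i j, z i j ω = 1 ∨ z i j ω = -1 :=
    ae_all_iff.2 fun i => ae_all_iff.2 fun j => (hz.isRademacher i j).ae_eq
  have hcover : ∀ᵐ ω ∂P, ω ∈ bad ∪ good := by
    filter_upwards [hsign] with ω hω
    by_cases hb : ω ∈ bad
    · exact Or.inl hb
    right
    rw [hbad, Set.mem_ofPred_eq, not_le] at hb
    set Y : Fin N → ℝ := fun i => ∑ j, -Real.log (hH.eigenvalues j) / W *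
      (∑ l, (hH.eigenvectorBasis j : Fin n → ℝ) l * z i l ω) ^ 2 with hY
    set q : Fin N → ℝ := fun i =>
      SLQ.lanczosQuadrature A m ((√(n : ℝ))⁻¹ • fun j => z i j ω) with hq
    -- `W * Y i` is the exact quadratic form of `-log A` at `z i`, while `n * q i` approximates that
    -- of `log A`, hence the plus sign. The factor `n` undoes the normalization by `√n`.
    have hquad : ∀ i, |n * q i + W * Y i| ≤ n * (2 * e) := by
      intro i
      set v : Fin n → ℝ := (√(n : ℝ))⁻¹ • fun j => z i j ω with hv
      have hsq : (√(n : ℝ))⁻¹ ^ 2 = (n : ℝ)⁻¹ := by rw [inv_pow, Real.sq_sqrt hn'.le]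
      have hv1 : v ⬝ᵥ v = 1 := by
        have h1 : ∀ j, z i j ω * z i j ω = 1 := fun j => by
          rcases hω i j with h | h <;> rw [h] <;> norm_num
        rw [hv, smul_dotProduct, dotProduct_smul, smul_smul, ← sq, hsq, dotProduct]
        simp [h1, hn'.ne']
      have herr := SLQ.abs_lanczosQuadrature_sub_le hH hv1 heig m hpdeg hp
      have hWY : W * Y i = -(n * ∑ j, ((hH.eigenvectorBasis j : Fin n → ℝ) ⬝ᵥ v) ^ 2 *
          Real.log (hH.eigenvalues j)) := by
        rw [hY, Finset.mul_sum, Finset.mul_sum, ← Finset.sum_neg_distrib]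
        refine Finset.sum_congr rfl fun j _ => ?_
        rw [hv, dotProduct_smul, smul_eq_mul, mul_pow, hsq, dotProduct]
        field_simp
      have : n * q i + W * Y i = -(n * (∑ j, ((hH.eigenvectorBasis j : Fin n → ℝ) ⬝ᵥ v) ^ 2 *
          Real.log (hH.eigenvalues j) - SLQ.lanczosQuadrature A m v)) := by
        rw [hWY]
        ring
      rw [this, abs_neg, abs_mul, abs_of_pos hn']
      exact mul_le_mul_of_nonneg_left herr hn'.le
    have hslq : SLQ.slqLogDet A m N (fun i j => z i j ω) = (∑ i, n * q i) / N := by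
      rw [SLQ.slqLogDet, ← Finset.mul_sum]
      ring
    have hsum : |∑ i, (n * q i + W * Y i)| ≤ N * (n * (2 * e)) := by
      refine (Finset.abs_sum_le_sum_abs _ _).trans ((Finset.sum_le_sum fun i _ => hquad i).trans ?_)
      simp
    -- Sampling error minus accumulated quadrature error.
    have hdecomp : Real.log A.det - SLQ.slqLogDet A m N (fun i j => z i j ω) =
        (W * (∑ i, Y i - N) - ∑ i, (n * q i + W * Y i)) / N := by
      rw [hslq, hWdet, Finset.sum_add_distrib, ← Finset.mul_sum (a := W)]
      field_simp
      ring
    rw [hgood, Set.mem_ofPred_eq, hdecomp, hWdet, abs_neg, abs_of_pos hWpos, abs_div,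
      abs_of_pos hNpos, div_le_iff₀ hNpos]
    calc _ ≤ |W * (∑ i, Y i - N)| + |∑ i, (n * q i + W * Y i)| := abs_sub _ _
      _ ≤ W * (N * (ε / 2)) + N * (ε / 2 * W) := by
          rw [abs_mul, abs_of_pos hWpos]
          exact add_le_add (mul_le_mul_of_nonneg_left hb.le hWpos.le)
            (hsum.trans (mul_le_mul_of_nonneg_left heW hNpos.le))
      _ = _ := by ring
  -- Covering almost every point and using subadditivity avoids any need for measurability of
  -- `good`.
  have h1 : P.real (bad ∪ good) = 1 := by
    have : (bad ∪ good : Set Ω) =ᵐ[P] Set.univ := Filter.eventuallyEq_univ.2 hcover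
    rw [measureReal_congr this, probReal_univ]
  have h2 := measureReal_union_le (μ := P) bad good
  linarith
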